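/- Let $H$ be a separable complex Hilbert space. A state on $H$ is a positive trace class operator $\rho$ on $H$ with $\operatorname{tr}\rho=1$; its von Neumann entropy is $S(\rho)=-\operatorname{tr}(\rho\log_2\rho)\in[0,\infty]$, with $0\log_2 0=0$. Let $\Phi\colon B(H)\to B(H)$ be a bi-stochastic quantum operation, that is, a linear map on the bounded operators of $H$ that is completely positive, normal (continuous for the ultraweak topology), unital ($\Phi(I)=I$) and trace-preserving (for every trace class operator $X$, $\Phi(X)$ is of trace class and $\operatorname{tr}\Phi(X)=\operatorname{tr}X$). Then $S(\Phi(\rho))=S(\rho)$ for every state $\rho$ on $H$ if and only if there is a unitary operator $U$ on $H$ such that $\Phi(X)=UXU^*$ for all $X\in B(H)$. -/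

import Mathlib

open scoped ENNReal InnerProductSpace CStarAlgebra Topology

namespace QuantumEntropy

/-- Parseval's identity in `[0, ∞]`. -/
theorem tsum_ofReal_norm_inner_sq {H : Type*} [NormedAddCommGroup H]
    [InnerProductSpace ℂ H] {ι : Type*} (b : HilbertBasis ι ℂ H) (x : H) :
    ∑' i, ENNReal.ofReal (‖⟪b i, x⟫_ℂ‖ ^ 2) = ENNReal.ofReal (‖x‖ ^ 2) := by
  have h := (b.hasSum_inner_mul_inner x x).mapL (RCLike.reCLM (K := ℂ))
  have e : ∀ i, RCLike.reCLM (K := ℂ) (⟪x, b i⟫_ℂ * ⟪b i, x⟫_ℂ) = ‖⟪b i, x⟫_ℂ‖ ^ 2 := by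
    intro i
    rw [← inner_conj_symm x (b i), RCLike.conj_mul, ← RCLike.ofReal_pow, RCLike.reCLM_apply,
      RCLike.ofReal_re]
  simp only [e] at h
  rw [← ENNReal.ofReal_tsum_of_nonneg (fun i => by positivity) h.summable, h.tsum_eq,
    RCLike.reCLM_apply, inner_self_eq_norm_sq]

section Trace

variable {H : Type*} [NormedAddCommGroup H] [InnerProductSpace ℂ H] [CompleteSpace H]

variable (H) in
/-- The index set of some orthonormal (Hilbert) basis of `H`. -/
noncomputable def basisSet : Set H := (exists_hilbertBasis ℂ H).choose

variable (H) in
/-- Some orthonormal (Hilbert) basis of `H`. -/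
noncomputable def basis : HilbertBasis (basisSet H) ℂ H :=
  (exists_hilbertBasis ℂ H).choose_spec.choose

/-- The trace `∑ i, ⟪e i, T e i⟫`, as an element of `[0, ∞]`, of a positive bounded operator. -/
noncomputable def posTrace (T : H →L[ℂ] H) : ℝ≥0∞ :=
  ∑' i, ENNReal.ofReal (RCLike.re ⟪basis H i, T (basis H i)⟫_ℂ)

/-- The trace of a positive operator can be computed in any orthonormal basis. -/
theorem posTrace_eq_tsum {ι : Type*} (b : HilbertBasis ι ℂ H) {T : H →L[ℂ] H} (hT : 0 ≤ T) :
    posTrace T = ∑' i, ENNReal.ofReal (RCLike.re ⟪b i, T (b i)⟫_ℂ) := by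
  obtain ⟨s, hs, rfl⟩ : ∃ s : H →L[ℂ] H, IsSelfAdjoint s ∧ s * s = T :=
    ⟨CFC.sqrt T, (CFC.sqrt_nonneg T).isSelfAdjoint, CFC.sqrt_mul_sqrt_self T hT⟩
  have hsym : ∀ x y : H, ⟪x, s y⟫_ℂ = ⟪s x, y⟫_ℂ := fun x y =>
    ((ContinuousLinearMap.isSelfAdjoint_iff_isSymmetric.mp hs) x y).symm
  have key : ∀ x : H, RCLike.re ⟪x, (s * s) x⟫_ℂ = ‖s x‖ ^ 2 := by
    intro x
    rw [mul_apply_eq_comp, hsym, inner_self_eq_norm_sq]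
  simp only [posTrace, key]
  calc ∑' i, ENNReal.ofReal (‖s (basis H i)‖ ^ 2)
      = ∑' i, ∑' j, ENNReal.ofReal (‖⟪b j, s (basis H i)⟫_ℂ‖ ^ 2) := by
        simp only [tsum_ofReal_norm_inner_sq]
    _ = ∑' j, ∑' i, ENNReal.ofReal (‖⟪b j, s (basis H i)⟫_ℂ‖ ^ 2) := ENNReal.tsum_comm
    _ = ∑' j, ∑' i, ENNReal.ofReal (‖⟪basis H i, s (b j)⟫_ℂ‖ ^ 2) := by
        simp only [hsym, norm_inner_symm]
    _ = ∑' j, ENNReal.ofReal (‖s (b j)‖ ^ 2) := by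
        simp only [tsum_ofReal_norm_inner_sq]

/-- `T` is of trace class: `tr |T| < ∞`, where `|T| = (T* T)^{1/2}`. -/
def IsTraceClass (T : H →L[ℂ] H) : Prop := posTrace (CFC.abs T) < ∞

/-- The trace of a trace class operator (the series converges absolutely for such operators). -/
noncomputable def trace (T : H →L[ℂ] H) : ℂ := ∑' i, ⟪basis H i, T (basis H i)⟫_ℂ

/-- Density operators (quantum states): positive trace class operators of trace one. -/
structure IsState (ρ : H →L[ℂ] H) : Prop where
  nonneg : 0 ≤ ρ
  isTraceClass : IsTraceClass ρ
  trace_eq_one : trace ρ = 1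

/-- The von Neumann entropy `S(ρ) = -tr (ρ log₂ ρ)`, an element of `[0, ∞]`. The positive operator
`-ρ log₂ ρ` is given by the continuous functional calculus for `t ↦ -t log₂ t`, with the
convention `0 log 0 = 0`. -/
noncomputable def entropy (ρ : H →L[ℂ] H) : ℝ≥0∞ :=
  posTrace (cfc (fun t : ℝ => -(t * Real.logb 2 t)) ρ)

end Trace

section Operations

variable {H : Type*} [NormedAddCommGroup H] [InnerProductSpace ℂ H] [CompleteSpace H]

variable (H) in
/-- The ultraweak (σ-weak) topology on the bounded operators: the coarsest topology for which all
functionals `T ↦ ∑ n, ⟪x n, T (y n)⟫` with `∑ ‖x n‖² < ∞` and `∑ ‖y n‖² < ∞` are continuous. -/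
noncomputable def ultraweakTopology : TopologicalSpace (H →L[ℂ] H) :=
  ⨅ (x : ℕ → H) (y : ℕ → H) (_ : Summable fun n => ‖x n‖ ^ 2) (_ : Summable fun n => ‖y n‖ ^ 2),
    TopologicalSpace.induced (fun T : H →L[ℂ] H => ∑' n, ⟪x n, T (y n)⟫_ℂ) inferInstance

/-- Normal maps: those that are continuous for the ultraweak topology. -/
def IsNormalMap (Φ : (H →L[ℂ] H) → (H →L[ℂ] H)) : Prop :=
  Continuous[ultraweakTopology H, ultraweakTopology H] Φ

/-- A completely positive map is a quantum operation if it is normal and `Φ(I) ≤ I`. -/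
structure IsQuantumOperation (Φ : (H →L[ℂ] H) →CP (H →L[ℂ] H)) : Prop where
  normal : IsNormalMap Φ
  map_one_le : Φ 1 ≤ 1

/-- `Φ` is trace-preserving: it maps trace class operators to trace class operators with the same
trace. -/
def IsTracePreserving (Φ : (H →L[ℂ] H) →CP (H →L[ℂ] H)) : Prop :=
  ∀ X : H →L[ℂ] H, IsTraceClass X → IsTraceClass (Φ X) ∧ trace (Φ X) = trace X

/-- Bi-stochastic quantum operations: trace-preserving and unital. -/
structure IsBistochastic (Φ : (H →L[ℂ] H) →CP (H →L[ℂ] H)) : Prop extends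
    IsQuantumOperation Φ where
  tracePreserving : IsTracePreserving Φ
  unital : Φ 1 = 1

end Operations

end QuantumEntropy

/-! Zero entropy detects pure states: `-t log₂ t` is nonnegative on `[0, 1]` and vanishes there only
at `0` and `1`. An entropy-preserving `Φ` thus maps each rank one projection to a projection of
trace one, again of rank one. By the Schwarz inequality such projections lie in the multiplicative
domain of `Φ` (`map_mul_of_isStarProjection`), and polarization extends this to all rank one
operators (`map_mul_rankOne`). If `Φ(|e⟩⟨e|) = |f⟩⟨f|`, then `U x = Φ(|x⟩⟨e|) f` is an isometry with
`Φ(X) U = U X`; normality and `Φ(1) = 1` give `U U* = 1`. Conversely, unitary conjugation commutes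
with the functional calculus and preserves the trace. -/

namespace QuantumEntropy

/-! ### Schwarz inequality and multiplicative domain -/

section Schwarz

variable {A B : Type*} [CStarAlgebra A] [PartialOrder A] [StarOrderedRing A]
  [CStarAlgebra B] [PartialOrder B] [StarOrderedRing B]

theorem cstarMatrix_apply_self_nonneg {n : Type*} [Fintype n] {M : CStarMatrix n n A}
    (hM : 0 ≤ M) (i : n) : 0 ≤ M i i := by
  rw [StarOrderedRing.nonneg_iff] at hM
  induction hM using AddSubmonoid.closure_induction with
  | mem M h =>
    obtain ⟨N, rfl⟩ := h
    simp only [CStarMatrix.mul_apply]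
    exact Finset.sum_nonneg fun k _ => star_mul_self_nonneg (N k i)
  | zero => exact le_rfl
  | add M N _ _ hM hN => exact add_nonneg hM hN

/-- The Schwarz inequality for unital completely positive maps. -/
theorem star_map_mul_map_le (Φ : A →CP B) (h1 : Φ 1 = 1) (a : A) :
    star (Φ a) * Φ a ≤ Φ (star a * a) := by
  -- `N* N = [[a* a, a*], [a, 1]]`. Compressing its image under `Φ` by the column `(1, -Φ a)` leaves
  -- `Φ(a* a) - Φ(a)* Φ(a)`.
  let N : CStarMatrix (Fin 2) (Fin 2) A := CStarMatrix.ofMatrix !![a, 1; 0, 0]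
  have h := Φ.map_cstarMatrix_nonneg (star N * N) (star_mul_self_nonneg N)
  let C : CStarMatrix (Fin 2) (Fin 2) B := CStarMatrix.ofMatrix !![1, 0; -Φ a, 0]
  have h2 := cstarMatrix_apply_self_nonneg (star_left_conjugate_nonneg h C) 0
  have hs : Φ (star a) = star (Φ a) := map_star Φ a
  simp only [CStarMatrix.mul_apply, Fin.sum_univ_two, CStarMatrix.map_apply,
    CStarMatrix.star_apply, N, C, CStarMatrix.ofMatrix_apply, Matrix.of_apply,
    Matrix.cons_val', Matrix.cons_val_zero, Matrix.cons_val_one, Matrix.cons_val_fin_one,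
    star_one, star_zero, star_neg, mul_one, one_mul, zero_mul, add_zero, h1, hs] at h2
  rw [← sub_nonneg]
  convert h2 using 1
  noncomm_ring

/-- From `(x q)* (x q) ≤ ‖x‖² q` and Schwarz, compression by `1 - Φ q` gives `Φ(x q)(1 - Φ q) = 0`.
The cases `q = p` and `q = 1 - p` combine to the claim. -/
theorem map_mul_of_isStarProjection (Φ : A →CP B) (h1 : Φ 1 = 1) {p : A}
    (hp : IsStarProjection p) (hp' : IsStarProjection (Φ p)) (x : A) :
    Φ (x * p) = Φ x * Φ p := by
  have key : ∀ q : A, IsStarProjection q → IsStarProjection (Φ q) →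
      Φ (x * q) * (1 - Φ q) = 0 := by
    intro q hq hq'
    rw [← CStarRing.star_mul_self_eq_zero_iff]
    refine le_antisymm ?_ (star_mul_self_nonneg _)
    have e1 : star (x * q) * (x * q) ≤ ‖x‖ ^ 2 • q := by
      have := star_left_conjugate_le_conjugate
        (CStarAlgebra.star_mul_le_algebraMap_norm_sq (a := x)) q
      rw [Algebra.algebraMap_eq_smul_one, mul_smul_comm, mul_one, smul_mul_assoc,
        hq.isSelfAdjoint.star_eq, hq.isIdempotentElem.eq] at this
      simpa [star_mul, hq.isSelfAdjoint.star_eq, mul_assoc] using this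
    have e2 : star (Φ (x * q)) * Φ (x * q) ≤ ‖x‖ ^ 2 • Φ q := by
      refine (star_map_mul_map_le Φ h1 _).trans ((OrderHomClass.mono Φ e1).trans_eq ?_)
      rw [← Complex.coe_smul, ← Complex.coe_smul, map_smul]
    have e3 := star_left_conjugate_le_conjugate e2 (1 - Φ q)
    rw [mul_smul_comm, smul_mul_assoc, mul_assoc _ (Φ q), hq'.mul_one_sub_self, mul_zero,
      smul_zero] at e3
    simpa [star_mul, mul_assoc] using e3
  have k1 := key p hp hp'
  have e : Φ (1 - p) = 1 - Φ p := by rw [map_sub, h1]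
  have k2 := key (1 - p) hp.one_sub (e ▸ hp'.one_sub)
  rw [e, sub_sub_cancel, mul_sub, mul_one, map_sub, sub_mul, sub_eq_zero] at k2
  rw [mul_sub, mul_one, sub_eq_zero] at k1
  rw [k1, k2]

end Schwarz

/-! ### Trace, pure states and zero entropy -/

section PosTrace

open InnerProductSpace ContinuousLinearMap

variable {H : Type*} [NormedAddCommGroup H] [InnerProductSpace ℂ H]

theorem re_inner_nonneg {T : H →L[ℂ] H} (hT : 0 ≤ T) (x : H) : 0 ≤ RCLike.re ⟪x, T x⟫_ℂ :=
  ((nonneg_iff_isPositive T).mp hT).re_inner_nonneg_right x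

variable [CompleteSpace H]

theorem posTrace_add {S T : H →L[ℂ] H} (hS : 0 ≤ S) (hT : 0 ≤ T) :
    posTrace (S + T) = posTrace S + posTrace T := by
  simp only [posTrace, add_apply, inner_add_right, map_add]
  rw [← ENNReal.tsum_add]
  exact tsum_congr fun i => ENNReal.ofReal_add (re_inner_nonneg hS _) (re_inner_nonneg hT _)

/-- Extend `x` to an orthonormal basis: the left side is one term of the trace. -/
theorem ofReal_re_inner_le_posTrace {T : H →L[ℂ] H} (hT : 0 ≤ T) {x : H} (hx : ‖x‖ = 1) :
    ENNReal.ofReal (RCLike.re ⟪x, T x⟫_ℂ) ≤ posTrace T := by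
  have ho : Orthonormal ℂ ((↑) : ({x} : Set H) → H) := by
    refine ⟨fun i => ?_, fun i j hij => (hij (Subsingleton.elim i j)).elim⟩
    rw [Set.mem_singleton_iff.mp i.2, hx]
  obtain ⟨w, b, hw, hb⟩ := ho.exists_hilbertBasis_extension
  rw [posTrace_eq_tsum b hT, hb]
  exact ENNReal.le_tsum (f := fun i : w => ENNReal.ofReal (RCLike.re ⟪(i : H), T i⟫_ℂ))
    ⟨x, hw rfl⟩

/-- Yields `ρ ≤ 1` for states, and faithfulness of the trace when `c = 0`. -/
theorem le_smul_one_of_posTrace_le {T : H →L[ℂ] H} (hT : 0 ≤ T) {c : ℝ} (hc : 0 ≤ c)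
    (h : posTrace T ≤ ENNReal.ofReal c) : T ≤ (c : ℂ) • 1 := by
  rw [le_def, isPositive_def']
  refine ⟨?_, fun x => ?_⟩
  · refine IsSelfAdjoint.sub ?_ (IsSelfAdjoint.of_nonneg hT)
    exact IsSelfAdjoint.smul (Complex.conj_ofReal c) (IsSelfAdjoint.one _)
  · rw [reApplyInnerSelf_apply, inner_re_symm]
    rcases eq_or_ne x 0 with rfl | hx
    · simp
    have hn : 0 < ‖x‖ := norm_pos_iff.mpr hx
    have h1 := (ENNReal.ofReal_le_ofReal_iff hc).mp
      ((ofReal_re_inner_le_posTrace hT (norm_smul_inv_norm (𝕜 := ℂ) hx)).trans h)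
    have e : RCLike.re ⟪((‖x‖ : ℂ)⁻¹) • x, T (((‖x‖ : ℂ)⁻¹) • x)⟫_ℂ
        = (‖x‖ ^ 2)⁻¹ * RCLike.re ⟪x, T x⟫_ℂ := by
      rw [map_smul, inner_smul_left, inner_smul_right, ← mul_assoc, ← Complex.ofReal_inv,
        Complex.conj_ofReal, ← Complex.ofReal_mul]
      rw [show (‖x‖ ^ 2)⁻¹ = ‖x‖⁻¹ * ‖x‖⁻¹ by rw [sq, mul_inv]]
      exact Complex.re_ofReal_mul _ _
    have h2 : (‖x‖ ^ 2)⁻¹ * RCLike.re ⟪x, T x⟫_ℂ ≤ c := e ▸ h1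
    rw [inv_mul_le_iff₀ (by positivity)] at h2
    have e2 : RCLike.re ⟪x, ((c : ℂ) • (1 : H →L[ℂ] H) - T) x⟫_ℂ
        = ‖x‖ ^ 2 * c - RCLike.re ⟪x, T x⟫_ℂ := by
      rw [sub_apply, smul_apply, one_apply_eq_self, inner_sub_right, inner_smul_right, map_sub,
        ← inner_self_eq_norm_sq (𝕜 := ℂ) x, mul_comm _ c]
      congr 1
      exact Complex.re_ofReal_mul _ _
    rw [e2]
    linarith

theorem eq_zero_of_posTrace_eq_zero {T : H →L[ℂ] H} (hT : 0 ≤ T) (h : posTrace T = 0) : T = 0 :=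
  le_antisymm (by simpa using le_smul_one_of_posTrace_le hT le_rfl (by simp [h])) hT

theorem posTrace_rankOne (x : H) : posTrace (rankOne ℂ x x) = ENNReal.ofReal (‖x‖ ^ 2) := by
  rw [← tsum_ofReal_norm_inner_sq (basis H) x]
  refine tsum_congr fun i => ?_
  rw [rankOne_apply, inner_smul_right, ← inner_conj_symm x, RCLike.conj_mul, ← RCLike.ofReal_pow,
    RCLike.ofReal_re]

theorem trace_rankOne (x : H) : trace (rankOne ℂ x x) = (‖x‖ : ℂ) ^ 2 := by
  rw [trace, ← RCLike.ofReal_eq_complex_ofReal, ← inner_self_eq_norm_sq_to_K (𝕜 := ℂ) x,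
    ← (basis H).tsum_inner_mul_inner x x]
  refine tsum_congr fun i => ?_
  rw [rankOne_apply, inner_smul_right]

theorem isTraceClass_iff_of_nonneg {T : H →L[ℂ] H} (hT : 0 ≤ T) :
    IsTraceClass T ↔ posTrace T < ∞ := by
  rw [IsTraceClass, CFC.abs_of_nonneg T hT]

theorem posTrace_eq_ofReal_trace {T : H →L[ℂ] H} (hT : 0 ≤ T) (h : IsTraceClass T) :
    posTrace T = ENNReal.ofReal (trace T).re := by
  rw [isTraceClass_iff_of_nonneg hT] at h
  set a : basisSet H → ℝ := fun i => RCLike.re ⟪basis H i, T (basis H i)⟫_ℂ with ha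
  have ha0 : ∀ i, 0 ≤ a i := fun i => re_inner_nonneg hT _
  have hs : Summable a := by
    refine (ENNReal.summable_toReal h.ne).congr fun i => ?_
    exact ENNReal.toReal_ofReal (ha0 i)
  have ht : trace T = ((∑' i, a i : ℝ) : ℂ) := by
    rw [trace, Complex.ofReal_tsum]
    refine tsum_congr fun i => ?_
    have := ((nonneg_iff_isPositive T).mp hT).inner_nonneg_right (basis H i)
    exact (RCLike.nonneg_iff_exists_ofReal.mp this).elim fun r hr => by
      simp [ha, ← hr.2]
  rw [ht, Complex.ofReal_re, ENNReal.ofReal_tsum_of_nonneg ha0 hs]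
  rfl

theorem IsState.posTrace_eq_one {ρ : H →L[ℂ] H} (h : IsState ρ) : posTrace ρ = 1 := by
  rw [posTrace_eq_ofReal_trace h.nonneg h.isTraceClass, h.trace_eq_one]
  simp

theorem IsState.le_one {ρ : H →L[ℂ] H} (h : IsState ρ) : ρ ≤ 1 := by
  simpa using le_smul_one_of_posTrace_le h.nonneg zero_le_one (by simp [h.posTrace_eq_one])

theorem isState_rankOne {x : H} (hx : ‖x‖ = 1) : IsState (rankOne ℂ x x) := by
  have h0 : 0 ≤ rankOne ℂ x x := (nonneg_iff_isPositive _).mpr (isPositive_rankOne_self x)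
  refine ⟨h0, (isTraceClass_iff_of_nonneg h0).mpr ?_, ?_⟩
  · simp [posTrace_rankOne]
  · simp [trace_rankOne, hx]

/-- A projection of trace one has rank one. -/
theorem exists_eq_rankOne {p : H →L[ℂ] H} (hp : IsStarProjection p) (h : posTrace p = 1) :
    ∃ f : H, ‖f‖ = 1 ∧ p = rankOne ℂ f f := by
  obtain ⟨x, hx⟩ : ∃ x, p x ≠ 0 := by
    by_contra! hc
    have : p = 0 := ext hc
    simp [this, posTrace] at h
  refine ⟨((‖p x‖ : ℂ)⁻¹) • p x, norm_smul_inv_norm (𝕜 := ℂ) hx, ?_⟩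
  set f := ((‖p x‖ : ℂ)⁻¹) • p x with hf
  have hf1 : ‖f‖ = 1 := norm_smul_inv_norm (𝕜 := ℂ) hx
  have hpf : p f = f := by
    rw [hf, map_smul, ← mul_apply_eq_comp, hp.isIdempotentElem.eq]
  -- The difference `p - |f⟩⟨f|` is a projection of trace zero, hence zero.
  have hq := (isStarProjection_rankOne_self (𝕜 := ℂ) hf1).sub_of_mul_eq_right hp
    (by rw [mul_def, comp_rankOne, hpf])
  have hq0 : 0 ≤ p - rankOne ℂ f f :=
    (nonneg_iff_isPositive _).mpr (.of_isStarProjection hq)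
  have hadd := posTrace_add hq0 (isState_rankOne hf1).nonneg
  rw [sub_add_cancel, h, posTrace_rankOne, hf1] at hadd
  have h0 : posTrace (p - rankOne ℂ f f) = 0 := by
    have : (0 : ℝ≥0∞) + 1 = posTrace (p - rankOne ℂ f f) + 1 := by simpa using hadd
    exact ((ENNReal.add_left_inj ENNReal.one_ne_top).mp this).symm
  exact sub_eq_zero.mp (eq_zero_of_posTrace_eq_zero hq0 h0)

theorem mem_Icc_of_mem_spectrum {ρ : H →L[ℂ] H} (h0 : 0 ≤ ρ) (h1 : ρ ≤ 1) {t : ℝ}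
    (ht : t ∈ spectrum ℝ ρ) : 0 ≤ t ∧ t ≤ 1 :=
  ⟨spectrum_nonneg_of_nonneg h0 ht,
    (CFC.le_one_iff (R := ℝ) ρ (IsSelfAdjoint.of_nonneg h0)).mp h1 t ht⟩

theorem cfc_entropy_nonneg {ρ : H →L[ℂ] H} (h0 : 0 ≤ ρ) (h1 : ρ ≤ 1) :
    0 ≤ cfc (fun t : ℝ => -(t * Real.logb 2 t)) ρ := by
  refine cfc_nonneg fun t ht => ?_
  obtain ⟨h, h'⟩ := mem_Icc_of_mem_spectrum h0 h1 ht
  exact neg_nonneg.mpr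
    (mul_nonpos_of_nonneg_of_nonpos h (Real.logb_nonpos one_lt_two h h'))

theorem continuous_neg_mul_logb : Continuous fun t : ℝ => -(t * Real.logb 2 t) := by
  have : (fun t : ℝ => -(t * Real.logb 2 t)) = fun t => -(t * Real.log t / Real.log 2) := by
    funext t; rw [Real.logb, mul_div_assoc]
  rw [this]
  exact (Real.continuous_mul_log.div_const _).neg

theorem entropy_eq_zero_of_isStarProjection {p : H →L[ℂ] H} (hp : IsStarProjection p) :
    entropy p = 0 := by
  have : cfc (fun t : ℝ => -(t * Real.logb 2 t)) p = 0 := by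
    rw [← cfc_zero ℝ p]
    refine cfc_congr fun t ht => ?_
    rcases hp.isIdempotentElem.spectrum_subset ℝ ht with rfl | rfl <;> simp
  simp [entropy, this, posTrace]

/-- Faithfulness of the trace makes `-ρ log₂ ρ` vanish, so the spectrum lies in the zero set `{0,
1}` of `-t log₂ t` on `[0, 1]`. -/
theorem isStarProjection_of_entropy_eq_zero {ρ : H →L[ℂ] H} (h0 : 0 ≤ ρ) (h1 : ρ ≤ 1)
    (h : entropy ρ = 0) : IsStarProjection ρ := by
  have hsa := IsSelfAdjoint.of_nonneg h0
  have hz := eq_zero_of_posTrace_eq_zero (cfc_entropy_nonneg h0 h1) h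
  rw [← cfc_zero ℝ ρ] at hz
  have heq := eqOn_of_cfc_eq_cfc hz (hf := continuous_neg_mul_logb.continuousOn)
    (hg := continuousOn_const) hsa
  refine ⟨(isIdempotentElem_iff_spectrum_subset ℝ ρ hsa).mpr fun t ht => ?_, hsa⟩
  have h2 := mem_Icc_of_mem_spectrum h0 h1 ht
  have h3 := heq ht
  simp only [Pi.zero_apply, neg_eq_zero, mul_eq_zero] at h3
  rcases h3 with h3 | h3
  · exact Or.inl h3
  · rcases Real.logb_eq_zero.mp h3 with h | h | h | h | h | h
    · norm_num at h
    · norm_num at h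
    · norm_num at h
    · exact Or.inl h
    · exact Or.inr h
    · linarith [h2.1]

theorem posTrace_unitary_conj {U : H →L[ℂ] H} (hU : U ∈ unitary (H →L[ℂ] H)) {T : H →L[ℂ] H}
    (hT : 0 ≤ T) : posTrace (U * T * star U) = posTrace T := by
  -- In the transported basis `U eᵢ` the two traces agree term by term.
  let b : HilbertBasis (basisSet H) ℂ H :=
    .ofRepr ((Unitary.linearIsometryEquiv ⟨U, hU⟩).symm.trans (basis H).repr)
  rw [posTrace_eq_tsum b (star_right_conjugate_nonneg hT U), posTrace]
  refine tsum_congr fun i => ?_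
  have e : b i = U (basis H i) := rfl
  rw [e, mul_apply_eq_comp, mul_apply_eq_comp, ← mul_apply_eq_comp (star U) U,
    (Unitary.mem_iff.mp hU).1, one_apply_eq_self, ← adjoint_inner_left, ← star_eq_adjoint,
    ← mul_apply_eq_comp, (Unitary.mem_iff.mp hU).1, one_apply_eq_self]

theorem entropy_unitary_conj {U : H →L[ℂ] H} (hU : U ∈ unitary (H →L[ℂ] H)) {ρ : H →L[ℂ] H}
    (hρ : IsState ρ) : entropy (U * ρ * star U) = entropy ρ := by
  have h := StarAlgHomClass.map_cfc (S := ℂ) (Unitary.conjStarAlgAut ℂ (H →L[ℂ] H) ⟨U, hU⟩)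
    (fun t : ℝ => -(t * Real.logb 2 t)) ρ continuous_neg_mul_logb.continuousOn
    (show Continuous fun X : H →L[ℂ] H => U * X * star U by fun_prop)
    (IsSelfAdjoint.of_nonneg hρ.nonneg)
    (IsSelfAdjoint.of_nonneg (by
      simpa using star_right_conjugate_nonneg hρ.nonneg U))
  simp only [Unitary.conjStarAlgAut_apply] at h
  rw [entropy, ← h, posTrace_unitary_conj hU (cfc_entropy_nonneg hρ.nonneg hρ.le_one), entropy]

end PosTrace

/-! ### Ultraweak convergence and normality -/

section Normal

open InnerProductSpace ContinuousLinearMap Filter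

variable {H : Type*} [NormedAddCommGroup H] [InnerProductSpace ℂ H]

/-- Use the sequences supported at index `0` with values `w` and `z`. -/
theorem continuous_ultraweak_inner (w z : H) :
    @Continuous _ _ (ultraweakTopology H) _ (fun T : H →L[ℂ] H => ⟪w, T z⟫_ℂ) := by
  have hs : ∀ v : H, Summable fun n : ℕ => ‖(Pi.single 0 v : ℕ → H) n‖ ^ 2 := fun v =>
    summable_of_ne_finset_zero (s := {0}) fun n hn => by
      rw [Pi.single_eq_of_ne (by simpa using hn)]; simp
  have e : (fun T : H →L[ℂ] H => ⟪w, T z⟫_ℂ) = fun T =>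
      ∑' n, ⟪(Pi.single 0 w : ℕ → H) n, T ((Pi.single 0 z : ℕ → H) n)⟫_ℂ := by
    funext T
    rw [tsum_eq_single 0 fun n hn => by rw [Pi.single_eq_of_ne hn]; simp]
    simp
  rw [e]
  exact continuous_iInf_dom (continuous_iInf_dom (continuous_iInf_dom (i := hs w)
    (continuous_iInf_dom (i := hs z) continuous_induced_dom)))

theorem sum_rankOne_apply {ι : Type*} (b : ι → H) (s : Finset ι) (w z : H) :
    ⟪w, (∑ i ∈ s, rankOne ℂ (b i) (b i)) z⟫_ℂ = ∑ i ∈ s, ⟪w, b i⟫_ℂ * ⟪b i, z⟫_ℂ := by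
  simp only [sum_apply, inner_sum, rankOne_apply, inner_smul_right, mul_comm]

/-- Cauchy–Schwarz and Bessel. The bound is uniform in `s`, as dominated convergence requires. -/
theorem norm_inner_sum_rankOne_le {ι : Type*} (b : HilbertBasis ι ℂ H) (s : Finset ι) (w z : H) :
    ‖⟪w, (∑ i ∈ s, rankOne ℂ (b i) (b i)) z⟫_ℂ‖ ≤ ‖w‖ * ‖z‖ := by
  rw [sum_rankOne_apply]
  refine (norm_sum_le _ _).trans ?_
  simp only [norm_mul]
  refine (Real.sum_mul_le_sqrt_mul_sqrt s _ _).trans ?_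
  refine mul_le_mul ?_ ?_ (Real.sqrt_nonneg _) (norm_nonneg _)
  · rw [Real.sqrt_le_left (norm_nonneg _)]
    simp only [norm_inner_symm w]
    exact b.orthonormal.sum_inner_products_le w
  · rw [Real.sqrt_le_left (norm_nonneg _)]
    exact b.orthonormal.sum_inner_products_le z

theorem tendsto_ultraweak_sum_rankOne {ι : Type*} (b : HilbertBasis ι ℂ H) :
    Tendsto (fun s : Finset ι => ∑ i ∈ s, rankOne ℂ (b i) (b i)) atTop
      (@nhds _ (ultraweakTopology H) 1) := by
  unfold ultraweakTopology
  simp only [nhds_iInf, tendsto_iInf, nhds_induced, tendsto_comap_iff]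
  intro x y hx hy
  refine tendsto_tsum_of_dominated_convergence (bound := fun n => ‖x n‖ * ‖y n‖) ?_ ?_ ?_
  · refine Summable.of_nonneg_of_le (fun n => by positivity) (fun n => ?_) (hx.add hy)
    nlinarith [sq_nonneg (‖x n‖ - ‖y n‖), sq_nonneg (‖x n‖ + ‖y n‖)]
  · intro n
    simp only [sum_rankOne_apply]
    exact b.hasSum_inner_mul_inner (x n) (y n)
  · exact .of_forall fun s n => norm_inner_sum_rankOne_le b s (x n) (y n)

theorem IsNormalMap.tendsto_inner {Φ : (H →L[ℂ] H) → (H →L[ℂ] H)} (hΦ : IsNormalMap Φ)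
    {ι : Type*} (b : HilbertBasis ι ℂ H) (w z : H) :
    Tendsto (fun s : Finset ι => ⟪w, Φ (∑ i ∈ s, rankOne ℂ (b i) (b i)) z⟫_ℂ) atTop
      (𝓝 ⟪w, Φ 1 z⟫_ℂ) := by
  let _ := ultraweakTopology H
  exact (((continuous_ultraweak_inner w z).comp hΦ).tendsto 1).comp
    (tendsto_ultraweak_sum_rankOne b)

end Normal

/-! ### Construction of the unitary -/

section Main

open InnerProductSpace ContinuousLinearMap Filter

variable {H : Type*} [NormedAddCommGroup H] [InnerProductSpace ℂ H] [CompleteSpace H]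

/-- Reduces multiplicativity on rank one operators to multiples of rank one projections. -/
theorem rankOne_polarization (x y : H) :
    rankOne ℂ x y = (1 / 4 : ℂ) • (rankOne ℂ (x + y) (x + y) - rankOne ℂ (x - y) (x - y)
      + Complex.I • rankOne ℂ (x + Complex.I • y) (x + Complex.I • y)
      - Complex.I • rankOne ℂ (x - Complex.I • y) (x - Complex.I • y)) := by
  simp only [map_add, map_sub, map_smulₛₗ, add_apply, sub_apply, smul_apply, Complex.conj_I,
    RingHom.id_apply]
  simp only [smul_add, smul_sub, smul_smul]
  simp only [mul_neg, neg_mul, Complex.I_mul_I, neg_neg, mul_one]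
  module

/-- A unital completely positive map that maps pure states to projections is multiplicative
with respect to rank one operators. -/
theorem map_mul_rankOne (Φ : (H →L[ℂ] H) →CP (H →L[ℂ] H)) (h1 : Φ 1 = 1)
    (h : ∀ x : H, ‖x‖ = 1 → IsStarProjection (Φ (rankOne ℂ x x))) (X : H →L[ℂ] H) (x y : H) :
    Φ (X * rankOne ℂ x y) = Φ X * Φ (rankOne ℂ x y) := by
  have hd : ∀ x : H, Φ (X * rankOne ℂ x x) = Φ X * Φ (rankOne ℂ x x) := by
    intro x
    rcases eq_or_ne x 0 with rfl | hx
    · simp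
    have hu : ‖((‖x‖ : ℂ)⁻¹) • x‖ = 1 := norm_smul_inv_norm (𝕜 := ℂ) hx
    have hn : (‖x‖ : ℂ) ≠ 0 := by simpa using hx
    have hx' : x = (‖x‖ : ℂ) • ((‖x‖ : ℂ)⁻¹ • x) := by rw [smul_smul, mul_inv_cancel₀ hn, one_smul]
    have := map_mul_of_isStarProjection Φ h1 (isStarProjection_rankOne_self (𝕜 := ℂ) hu)
      (h _ hu) X
    generalize ((‖x‖ : ℂ)⁻¹) • x = u at *
    rw [hx']
    simp only [map_smulₛₗ, smul_apply, mul_smul_comm, RingHom.id_apply, this]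
  rw [rankOne_polarization x y]
  simp only [mul_smul_comm, mul_add, mul_sub, map_smul Φ, map_add Φ, map_sub Φ, hd]

theorem exists_unitary_of_map_rankOne (Φ : (H →L[ℂ] H) →CP (H →L[ℂ] H)) (h1 : Φ 1 = 1)
    (hn : IsNormalMap Φ)
    (h : ∀ x : H, ‖x‖ = 1 → ∃ f : H, ‖f‖ = 1 ∧ Φ (rankOne ℂ x x) = rankOne ℂ f f) :
    ∃ U ∈ unitary (H →L[ℂ] H), ∀ X : H →L[ℂ] H, Φ X = U * X * star U := by
  rcases subsingleton_or_nontrivial H with hH | hH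
  · exact ⟨1, one_mem _, fun X => Subsingleton.elim _ _⟩
  obtain ⟨e, he⟩ := exists_norm_eq H zero_le_one
  obtain ⟨f, hf, hef⟩ := h e he
  have hmul := map_mul_rankOne Φ h1 fun x hx => by
    obtain ⟨g, hg, h⟩ := h x hx
    exact h ▸ isStarProjection_rankOne_self hg
  have hadj : ∀ x y : H, star (Φ (rankOne ℂ x y)) = Φ (rankOne ℂ y x) := fun x y => by
    rw [← map_star, star_eq_adjoint, adjoint_rankOne]
  have hcomp : ∀ x y z w : H, rankOne ℂ x y * rankOne ℂ z w = ⟪y, z⟫_ℂ • rankOne ℂ x w :=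
    fun x y z w => rankOne_comp_rankOne x y z w
  -- Isometric because `Φ(|x⟩⟨e|)* Φ(|y⟩⟨e|) = Φ(|e⟩⟨x| |y⟩⟨e|) = ⟪x, y⟫ |f⟩⟨f|`.
  let V : H →ₗ[ℂ] H :=
    { toFun := fun x => Φ (rankOne ℂ x e) f
      map_add' := by simp
      map_smul' := by simp }
  have hV : ∀ x y, ⟪V x, V y⟫_ℂ = ⟪x, y⟫_ℂ := by
    intro x y
    change ⟪Φ (rankOne ℂ x e) f, Φ (rankOne ℂ y e) f⟫_ℂ = _
    rw [← adjoint_inner_right, ← star_eq_adjoint, hadj, ← mul_apply_eq_comp, ← hmul, hcomp,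
      map_smul, hef, smul_apply, rankOne_apply, inner_smul_right, inner_smul_right,
      inner_self_eq_norm_sq_to_K, hf]
    simp
  let W : H →ₗᵢ[ℂ] H := V.isometryOfInner hV
  let U : H →L[ℂ] H := W.toContinuousLinearMap
  have hUx : ∀ x, U x = Φ (rankOne ℂ x e) f := fun x => rfl
  have hU1 : star U * U = 1 := by
    ext x
    refine ext_inner_left ℂ fun y => ?_
    rw [mul_apply_eq_comp, star_eq_adjoint, adjoint_inner_right, one_apply_eq_self]
    exact hV y x
  have hint : ∀ X, Φ X * U = U * X := by
    intro X
    ext x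
    rw [mul_apply_eq_comp, mul_apply_eq_comp, hUx, hUx, ← mul_apply_eq_comp, ← hmul, mul_def,
      comp_rankOne]
  have hleft : ∀ x, Φ (rankOne ℂ x e) = rankOne ℂ (U x) f := by
    intro x
    have : rankOne ℂ x e = rankOne ℂ x e * rankOne ℂ e e := by rw [hcomp]; simp [he]
    rw [this, hmul, hef, mul_def, comp_rankOne, hUx]
  have hR : ∀ x, Φ (rankOne ℂ x x) = rankOne ℂ (U x) (U x) := by
    intro x
    have : rankOne ℂ x x = rankOne ℂ x e * rankOne ℂ e x := by rw [hcomp]; simp [he]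
    rw [this, hmul, ← hadj x e, hleft, star_eq_adjoint, adjoint_rankOne, hcomp]
    simp [hf]
  -- The partial sums of `∑ |U eᵢ⟩⟨U eᵢ|` converge weakly to `U U*`, and by normality also to `Φ(1)
  -- = 1`.
  have hU2 : U * star U = 1 := by
    ext z
    refine ext_inner_left ℂ fun w => ?_
    have l1 := hn.tendsto_inner (basis H) w z
    have l2 := (basis H).hasSum_inner_mul_inner (star U w) (star U z)
    have e : ∀ s : Finset (basisSet H),
        ⟪w, Φ (∑ i ∈ s, rankOne ℂ (basis H i) (basis H i)) z⟫_ℂ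
          = ∑ i ∈ s, ⟪star U w, basis H i⟫_ℂ * ⟪basis H i, star U z⟫_ℂ := by
      intro s
      simp only [map_sum, hR, sum_rankOne_apply, star_eq_adjoint, adjoint_inner_left,
        adjoint_inner_right]
    simp only [e, h1] at l1
    rw [tendsto_nhds_unique l1 l2, star_eq_adjoint, mul_apply_eq_comp, adjoint_inner_left]
  refine ⟨U, Unitary.mem_iff.mpr ⟨hU1, hU2⟩, fun X => ?_⟩
  rw [← hint, mul_assoc, hU2, mul_one]

end Main
end QuantumEntropy

open QuantumEntropy InnerProductSpace in
theorem corollary3p10 {H : Type*} [NormedAddCommGroup H] [InnerProductSpace ℂ H] [CompleteSpace H]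
    [TopologicalSpace.SeparableSpace H]
    (Φ : (H →L[ℂ] H) →CP (H →L[ℂ] H)) (hΦ : QuantumEntropy.IsBistochastic Φ) :
    (∀ ρ : H →L[ℂ] H, QuantumEntropy.IsState ρ →
        QuantumEntropy.entropy (Φ ρ) = QuantumEntropy.entropy ρ) ↔
      ∃ U ∈ unitary (H →L[ℂ] H), ∀ X : H →L[ℂ] H, Φ X = U * X * star U := by
  constructor
  · intro h
    -- Entropy preservation is needed only on pure states.
    refine exists_unitary_of_map_rankOne Φ hΦ.unital hΦ.normal fun x hx => ?_
    have hρ := isState_rankOne hx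
    have hpos : 0 ≤ Φ (rankOne ℂ x x) := map_nonneg Φ hρ.nonneg
    have hle : Φ (rankOne ℂ x x) ≤ 1 := hΦ.unital ▸ OrderHomClass.mono Φ hρ.le_one
    obtain ⟨htc, htr⟩ := hΦ.tracePreserving _ hρ.isTraceClass
    have hS : IsState (Φ (rankOne ℂ x x)) := ⟨hpos, htc, htr.trans hρ.trace_eq_one⟩
    refine exists_eq_rankOne (isStarProjection_of_entropy_eq_zero hpos hle ?_) hS.posTrace_eq_one
    rw [h _ hρ]
    exact entropy_eq_zero_of_isStarProjection (isStarProjection_rankOne_self hx)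
  · rintro ⟨U, hU, hΦU⟩ ρ hρ
    rw [hΦU, entropy_unitary_conj hU hρ]
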